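/- Let $G$ be a finite simple graph. A set $S \subseteq V(G)$ is *dominating* if every vertex of $G$ not in $S$ is adjacent to some vertex of $S$. The *TARS-graph* $\varepsilon(G)$ is the simple graph whose vertices are the dominating sets of $G$, where two dominating sets $X$ and $Y$ are adjacent if and only if 1. $Y$ is obtained from $X$ by adding or deleting a single vertex of $G$ (token addition/removal); or 2. there are vertices $u \in X$ and $v \in Y \setminus X$ that are adjacent in $G$ and satisfy $Y = (X \cup \{v\}) \setminus \{u\}$ (token sliding). A graph on $n$ vertices is *pancyclic* if it contains a cycle of length $\ell$ for every integer $\ell$ with $3 \le \ell \le n$. **Corollary.** For every finite tree $T$, the TARS-graph $\varepsilon(T)$ is pancyclic. -/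

import Mathlib

namespace SimpleGraph

/-- A set `S` of vertices dominates `G` if every vertex outside `S` has a neighbour in `S`. -/
def IsDominating {V : Type*} (G : SimpleGraph V) (S : Finset V) : Prop :=
  ∀ v, v ∉ S → ∃ u ∈ S, G.Adj u v

/-- Token addition/removal: `Y` is obtained from `X` by adding or deleting a single vertex. -/
def TokenAddRemove {V : Type*} [DecidableEq V] (X Y : Finset V) : Prop :=
  (∃ v, v ∉ X ∧ Y = insert v X) ∨ (∃ v, v ∈ X ∧ Y = X.erase v)

/-- Token sliding: `Y = (X ∪ {v}) \ {u}` for adjacent vertices `u ∈ X` and `v ∈ Y \ X`. -/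
def TokenSlide {V : Type*} [DecidableEq V] (G : SimpleGraph V) (X Y : Finset V) : Prop :=
  ∃ u v, u ∈ X ∧ v ∈ Y \ X ∧ G.Adj u v ∧ Y = (insert v X).erase u

theorem TokenAddRemove.symm {V : Type*} [DecidableEq V] {X Y : Finset V}
    (h : TokenAddRemove X Y) : TokenAddRemove Y X := by
  rcases h with ⟨v, hv, rfl⟩ | ⟨v, hv, rfl⟩
  · exact Or.inr ⟨v, Finset.mem_insert_self v X, (Finset.erase_insert hv).symm⟩
  · exact Or.inl ⟨v, Finset.notMem_erase v X, (Finset.insert_erase hv).symm⟩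

theorem TokenSlide.symm {V : Type*} [DecidableEq V] {G : SimpleGraph V} {X Y : Finset V}
    (h : G.TokenSlide X Y) : G.TokenSlide Y X := by
  obtain ⟨u, v, hu, hv, huv, rfl⟩ := h
  have hvX : v ∉ X := (Finset.mem_sdiff.mp hv).2
  refine ⟨v, u, (Finset.mem_sdiff.mp hv).1, by simp [hu], huv.symm, ?_⟩
  rw [Finset.insert_erase (Finset.mem_insert_of_mem hu), Finset.erase_insert hvX]

/-- The TARS-graph of `G`: its vertices are the dominating sets of `G`, and two of them are
adjacent if one is obtained from the other by token addition/removal or by token sliding. -/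
def tarsGraph {V : Type*} [DecidableEq V] (G : SimpleGraph V) :
    SimpleGraph {S : Finset V // G.IsDominating S} where
  Adj X Y := TokenAddRemove X.1 Y.1 ∨ G.TokenSlide X.1 Y.1
  symm := ⟨fun _ _ h => h.imp TokenAddRemove.symm TokenSlide.symm⟩
  loopless := ⟨by
    rintro ⟨X, _⟩ ((⟨v, hv, h⟩ | ⟨v, hv, h⟩) | ⟨u, v, _, hv, _, _⟩)
    · exact hv (h ▸ Finset.mem_insert_self v X)
    · exact Finset.notMem_erase v X (h ▸ hv)
    · simp at hv⟩

/-- A finite graph on `n` vertices is pancyclic if it has a cycle of every length `ℓ` with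
`3 ≤ ℓ ≤ n`. -/
def IsPancyclic {W : Type*} [Finite W] (G : SimpleGraph W) : Prop :=
  ∀ ℓ : ℕ, 3 ≤ ℓ → ℓ ≤ Nat.card W → ∃ (w : W) (c : G.Walk w w), c.IsCycle ∧ c.length = ℓ

end SimpleGraph

/-!
Induct on the vertex set `U` of an induced subgraph of the forest. A longest path yields a vertex
`v` whose neighbours, with at most one exception `w`, form a nonempty set `L` of leaves; let `H` be
the rest of the graph. A dominating set that misses `v` is `Q ∪ L` for some dominating set `Q` of
`H`. If a dominating set `S` contains `v`, then `S ∩ H` dominates `H` except possibly `w`; adding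
`w` where necessary again gives a dominating set `Q` of `H`. Over each `Q` there thus stands a
column: the apex `Q ∪ L`, and an interval of the Boolean lattice with top `Q ∪ {v} ∪ L`, that is, a
cube. The apex is joined by token moves to the top and to all coatoms of the cube, so the cube
together with its apex has cycles of all lengths.

Adjacent dominating sets of `H` give columns that are linked at their apices, at their tops and at
corresponding coatoms. By induction the dominating sets of `H` lie on a Hamiltonian path. Going out
along it through the cubes, alternately from top to coatom and from coatom to top, and back along
the apices yields cycles of all lengths: top and coatom of a cube are joined only by paths of even
order, so outside the first column an order may be missed by one, but the first cube has paths of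
every order from a neighbour of its apex to a fixed coatom and makes up for the difference.
-/

namespace TarsGraph

open Finset SimpleGraph

section Paths

variable {α : Type*} {Γ Γ' : SimpleGraph α} {K K' : Finset α} {x y z x' y' : α} {m n : ℕ}

/-- There is a path of `Γ` from `x` to `y` on exactly `n` vertices, all of them in `K`. Counting
vertices rather than edges makes the orders of concatenated paths add up. -/
def HasPath (Γ : SimpleGraph α) (K : Finset α) (x y : α) (n : ℕ) : Prop :=
  ∃ p : Γ.Walk x y, p.IsPath ∧ p.length + 1 = n ∧ ∀ a ∈ p.support, a ∈ K

namespace HasPath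

theorem singleton (hx : x ∈ K) : HasPath Γ K x x 1 :=
  ⟨.nil, .nil, rfl, by simpa using hx⟩

theorem mono (h : HasPath Γ K x y n) (hK : K ⊆ K') : HasPath Γ K' x y n :=
  let ⟨p, hp, hn, hpK⟩ := h
  ⟨p, hp, hn, fun a ha => hK (hpK a ha)⟩

theorem mono_graph (h : HasPath Γ K x y n) (hΓ : Γ ≤ Γ') : HasPath Γ' K x y n :=
  let ⟨p, hp, hn, hpK⟩ := h
  ⟨p.mapLe hΓ, hp.mapLe hΓ, by simpa using hn, by simpa using hpK⟩

theorem left_mem (h : HasPath Γ K x y n) : x ∈ K :=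
  let ⟨p, _, _, hpK⟩ := h
  hpK x p.start_mem_support

theorem symm (h : HasPath Γ K x y n) : HasPath Γ K y x n :=
  let ⟨p, hp, hn, hpK⟩ := h
  ⟨p.reverse, hp.reverse, by simpa using hn, by simpa using hpK⟩

/-- At least three vertices are needed: a path on two vertices closes up to a single edge. -/
theorem exists_isCycle_induce {s : Set α} (h : HasPath Γ K x y n) (hyx : Γ.Adj y x)
    (hn : 3 ≤ n) (hK : ∀ a ∈ K, a ∈ s) :
    ∃ (w : s) (c : (Γ.induce s).Walk w w), c.IsCycle ∧ c.length = n := by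
  obtain ⟨p, hp, hlength, hpK⟩ := h
  have hps : ∀ a ∈ p.support, a ∈ s := fun a ha => hK a (hpK a ha)
  let q := p.induce s hps
  have hq : q.map (Embedding.induce s).toHom = p := p.map_induce hps
  have hyx' : (Γ.induce s).Adj ⟨y, hps y p.end_mem_support⟩ ⟨x, hps x p.start_mem_support⟩ := hyx
  have hqp : q.length = p.length := (q.length_map _).symm.trans (congrArg Walk.length hq)
  have hc : (q.cons hyx').length = n := by rw [Walk.length_cons, hqp, hlength]
  refine ⟨_, q.cons hyx', ?_, hc⟩
  rw [Walk.isCycle_iff_isPath_tail_and_le_length, hc]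
  exact ⟨by simpa using Walk.IsPath.of_map (hq ▸ hp), hn⟩

variable [DecidableEq α]

theorem append (h : HasPath Γ K x y m) (hyx' : Γ.Adj y x') (h' : HasPath Γ K' x' y' n)
    (hK : Disjoint K K') : HasPath Γ (K ∪ K') x y' (m + n) := by
  obtain ⟨p, hp, rfl, hpK⟩ := h
  obtain ⟨q, hq, rfl, hqK'⟩ := h'
  have hsupport : (p.append (q.cons hyx')).support = p.support ++ q.support := by
    simp [Walk.support_append]
  refine ⟨p.append (q.cons hyx'), ?_, by simp only [Walk.length_append, Walk.length_cons]; omega,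
    ?_⟩
  · rw [Walk.isPath_def, hsupport, List.nodup_append']
    exact ⟨hp.support_nodup, hq.support_nodup, fun a ha ha' =>
      Finset.disjoint_left.mp hK (hpK a ha) (hqK' a ha')⟩
  · rw [hsupport]
    intro a ha
    exact mem_union.mpr ((List.mem_append.mp ha).imp (hpK a) (hqK' a))

theorem cons (hxy : Γ.Adj x y) (h : HasPath Γ K y z n) (hx : x ∉ K) :
    HasPath Γ (insert x K) x z (n + 1) := by
  rw [insert_eq, add_comm]
  exact (singleton (mem_singleton_self x)).append hxy h (disjoint_singleton_left.mpr hx)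

theorem concat (h : HasPath Γ K x y n) (hyz : Γ.Adj y z) (hz : z ∉ K) :
    HasPath Γ (insert z K) x z (n + 1) :=
  (h.symm.cons hyz.symm hz).symm

theorem exists_erase_left (h : HasPath Γ K x y (n + 2)) :
    ∃ x', Γ.Adj x x' ∧ HasPath Γ (K.erase x) x' y (n + 1) := by
  obtain ⟨p, hp, hn, hpK⟩ := h
  cases p with
  | nil => simp at hn
  | @cons _ x' _ hxx' q =>
    rw [Walk.cons_isPath_iff] at hp
    refine ⟨x', hxx', q, hp.1, by simpa using hn, fun a ha => mem_erase.mpr ⟨?_, ?_⟩⟩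
    · rintro rfl
      exact hp.2 ha
    · exact hpK a (by simp [ha])

end HasPath

/-- `Γ` has a path through all vertices of `s`, that is, `Γ` induces on `s` a graph with a
Hamiltonian path. -/
def IsTraceableOn (Γ : SimpleGraph α) (s : Finset α) : Prop :=
  ∃ x y, HasPath Γ s x y #s

/-- `Γ` has a cycle inside `s` of every length from `3` to `#s`. A cycle is encoded as a path whose
ends are adjacent. -/
def IsPancyclicOn (Γ : SimpleGraph α) (s : Finset α) : Prop :=
  ∀ n, 3 ≤ n → n ≤ #s → ∃ x y, Γ.Adj y x ∧ HasPath Γ s x y n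

theorem IsPancyclicOn.isTraceableOn {s : Finset α} (h : IsPancyclicOn Γ s) (hs : 3 ≤ #s) :
    IsTraceableOn Γ s :=
  let ⟨x, y, _, hxy⟩ := h #s hs le_rfl
  ⟨x, y, hxy⟩

theorem isTraceableOn_singleton (x : α) : IsTraceableOn Γ {x} :=
  ⟨x, x, .singleton (mem_singleton_self x)⟩

theorem isPancyclicOn_singleton (x : α) : IsPancyclicOn Γ {x} := by
  intro n hn hcard
  rw [card_singleton] at hcard
  omega

end Paths

section Intervals

variable {V : Type*} [DecidableEq V] {A B : Finset V} {a l : V} {n : ℕ}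

theorem Icc_insert_union_Icc_erase (ha : a ∈ A \ B) :
    Icc (insert a B) A ∪ Icc B (A.erase a) = Icc B A := by
  ext X
  simp only [mem_union, mem_Icc, insert_subset_iff, subset_erase, mem_sdiff] at ha ⊢
  tauto

theorem disjoint_Icc_insert_Icc_erase : Disjoint (Icc (insert a B) A) (Icc B (A.erase a)) := by
  rw [Finset.disjoint_left]
  intro X hX hX'
  exact (subset_erase.mp (mem_Icc.mp hX').2).2 ((mem_Icc.mp hX).1 (mem_insert_self a B))

theorem even_card_Icc (hBA : B ⊆ A) (hl : l ∈ A \ B) : Even #(Icc B A) := by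
  rw [card_Icc_finset hBA, ← card_sdiff_of_subset hBA]
  exact even_two.pow_of_ne_zero (card_ne_zero_of_mem hl)

theorem two_le_card_Icc (hBA : B ⊆ A) (hl : l ∈ A \ B) : 2 ≤ #(Icc B A) := by
  have hcard : 0 < #(Icc B A) := (nonempty_Icc.mpr hBA).card_pos
  obtain ⟨k, hk⟩ := even_card_Icc hBA hl
  omega

theorem exists_eq_erase_of_hasse_adj {X : Finset V} (h : (hasse (Finset V)).Adj A X)
    (hX : X ∈ Icc B A) : ∃ a ∈ A \ B, X = A.erase a := by
  rw [mem_Icc] at hX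
  rcases hasse_adj.mp h with hAX | hXA
  · exact absurd hX.2 hAX.lt.not_ge
  · obtain ⟨a, ha, rfl⟩ := covBy_iff_exists_erase.mp hXA
    exact ⟨a, mem_sdiff.mpr ⟨ha, fun haB => notMem_erase a A (hX.1 haB)⟩, rfl⟩

theorem hasse_adj_erase (ha : a ∈ A) : (hasse (Finset V)).Adj A (A.erase a) :=
  hasse_adj.mpr (.inr (erase_covBy ha))

theorem hasPath_Icc_of_detour {X : Finset V} {k m : ℕ} (ha : a ∈ A \ B)
    (hupper : HasPath (hasse (Finset V)) (Icc (insert a B) A) A X (k + 2))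
    (hlower : ∀ b ∈ A.erase a \ B, HasPath (hasse (Finset V)) (Icc B (A.erase a)) (A.erase a)
      ((A.erase a).erase b) m) :
    HasPath (hasse (Finset V)) (Icc B A) A X (k + 2 + m) := by
  obtain ⟨haA, -⟩ := mem_sdiff.mp ha
  obtain ⟨Y, hAY, hY⟩ := hupper.exists_erase_left
  obtain ⟨b, hb, rfl⟩ := exists_eq_erase_of_hasse_adj hAY (mem_erase.mp hY.left_mem).2
  obtain ⟨hbA, hba, hbB⟩ : b ∈ A ∧ b ≠ a ∧ b ∉ B := by simpa using hb
  have hlink : (hasse (Finset V)).Adj ((A.erase a).erase b) (A.erase b) := by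
    rw [erase_right_comm]
    exact (hasse_adj_erase (mem_erase.mpr ⟨hba.symm, haA⟩)).symm
  have hdisjoint : Disjoint (Icc B (A.erase a)) ((Icc (insert a B) A).erase A) :=
    (disjoint_Icc_insert_Icc_erase.mono_left (erase_subset _ _)).symm
  have hdetour := (hlower b (by simp [hbA, hba, hbB])).append hlink hY hdisjoint
  have hA : A ∉ Icc B (A.erase a) ∪ (Icc (insert a B) A).erase A := by
    simp [subset_erase, haA]
  have hsubset : insert A (Icc B (A.erase a) ∪ (Icc (insert a B) A).erase A) ⊆ Icc B A := by
    rw [← Icc_insert_union_Icc_erase ha, union_comm (Icc (insert a B) A)]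
    exact insert_subset (mem_union_right _ hupper.left_mem)
      (union_subset_union_right (erase_subset _ _))
  have hpath := (hdetour.cons (hasse_adj_erase haA) hA).mono hsubset
  rwa [show m + (k + 1) + 1 = k + 2 + m by omega] at hpath

/-- Split the cube along a coordinate `a ≠ l`. A short path stays in the upper half; a long one is a
path spanning the upper half whose first edge is replaced by a detour through the lower half. -/
theorem hasPath_Icc (hBA : B ⊆ A) (hl : l ∈ A \ B) (hn : Even n) (hn2 : 2 ≤ n)
    (hcard : n ≤ #(Icc B A)) : HasPath (hasse (Finset V)) (Icc B A) A (A.erase l) n := by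
  induction hd : #(A \ B) using Nat.strong_induction_on generalizing A B l n with
  | _ d ih =>
    subst hd
    obtain ⟨hlA, hlB⟩ := mem_sdiff.mp hl
    obtain hsingle | hnontrivial := eq_singleton_or_nontrivial hl
    · have hn' : n = 2 := by
        rw [card_Icc_finset hBA, ← card_sdiff_of_subset hBA, hsingle, card_singleton] at hcard
        omega
      subst hn'
      refine ((HasPath.singleton (mem_singleton_self _)).cons (hasse_adj_erase hlA) ?_).mono ?_
      · simpa using (erase_ne_self.mpr hlA).symm
      · simp [insert_subset_iff, hBA, subset_erase, hlB, erase_subset]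
    · obtain ⟨a, ha, hal⟩ := hnontrivial.exists_ne l
      obtain ⟨haA, haB⟩ := mem_sdiff.mp ha
      have hupperBA : insert a B ⊆ A := insert_subset haA hBA
      have hlupper : l ∈ A \ insert a B := by simp [hlA, hlB, hal.symm]
      have hupper {m : ℕ} (hm : Even m) (hm2 : 2 ≤ m) (hmcard : m ≤ #(Icc (insert a B) A)) :=
        ih #(A \ insert a B) (card_lt_card (by grind)) hupperBA hlupper hm hm2 hmcard rfl
      have heven : Even #(Icc (insert a B) A) := even_card_Icc hupperBA hlupper
      rcases le_or_gt n #(Icc (insert a B) A) with hshort | hlong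
      · exact (hupper hn hn2 hshort).mono (Icc_subset_Icc_left (subset_insert a B))
      · obtain ⟨k, hk⟩ : ∃ k, #(Icc (insert a B) A) = k + 2 :=
          Nat.exists_eq_add_of_le' (two_le_card_Icc hupperBA hlupper)
        obtain ⟨m, rfl⟩ : ∃ m, n = k + 2 + m := Nat.exists_eq_add_of_le (by omega)
        have hm : Even m := (Nat.even_add.mp hn).mp (hk ▸ heven)
        have hmcard : m ≤ #(Icc B (A.erase a)) := by
          have := card_union_le (Icc (insert a B) A) (Icc B (A.erase a))
          rw [Icc_insert_union_Icc_erase ha] at this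
          omega
        refine hasPath_Icc_of_detour ha (hupper (hk ▸ heven) (by omega) hk.ge) fun b hb => ?_
        exact ih #(A.erase a \ B) (card_lt_card (by grind)) (subset_erase.mpr ⟨hBA, haB⟩) hb hm
          (by grind) hmcard rfl

end Intervals

section Strips

variable {α ι : Type*} {Γ : SimpleGraph α} {H : SimpleGraph ι}

/-- The data of a column: a body with two distinguished vertices `top` and `bot`, and an apex
outside the body. -/
structure Column (α : Type*) where
  apex : α
  top : α
  bot : α
  body : Finset α

variable [DecidableEq α]

namespace Column

variable {C : Column α} {M : Finset α} {s s' p q : α} {m n : ℕ}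

/-- The body of a column together with its apex. -/
def vertices (C : Column α) : Finset α :=
  insert C.apex C.body

/-- The conditions on a column in `Γ` under which paths can be routed through it with good control
over their orders. -/
structure IsTraversable (C : Column α) (Γ : SimpleGraph α) : Prop where
  apex_notMem : C.apex ∉ C.body
  even_card_body : Even #C.body
  two_le_card_body : 2 ≤ #C.body
  adj_apex_top : Γ.Adj C.apex C.top
  adj_apex_bot : Γ.Adj C.apex C.bot
  hasPath_top_bot : ∀ n, Even n → 2 ≤ n → n ≤ #C.body → HasPath Γ C.body C.top C.bot n
  exists_hasPath_bot : ∀ n, 1 ≤ n → n ≤ #C.body →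
    ∃ x, Γ.Adj C.apex x ∧ HasPath Γ C.body x C.bot n

namespace IsTraversable

variable (hC : C.IsTraversable Γ)
include hC

theorem card_vertices : #C.vertices = #C.body + 1 :=
  card_insert_of_notMem hC.apex_notMem

theorem hasPath_detour (hs : HasPath Γ C.body s s' m) (hs'p : Γ.Adj s' p)
    (hM : HasPath Γ M p q n) (hq : Γ.Adj q C.apex) (hdisjoint : Disjoint C.vertices M) :
    HasPath Γ (C.vertices ∪ M) s C.apex (m + n + 1) := by
  obtain ⟨hapex, hbody⟩ := disjoint_insert_left.mp hdisjoint
  rw [vertices, insert_union]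
  exact (hs.append hs'p hM hbody).concat hq (by simp [hC.apex_notMem, hapex])

theorem exists_hasPath_apex (hn : 1 ≤ n) (hcard : n ≤ #C.vertices) :
    ∃ n', n ≤ n' ∧ n' ≤ n + 1 ∧ n' ≤ #C.vertices ∧
      HasPath Γ C.vertices C.top C.apex n' ∧ HasPath Γ C.vertices C.bot C.apex n' := by
  rw [hC.card_vertices] at hcard ⊢
  have htwo := hC.two_le_card_body
  rcases hn.eq_or_lt with rfl | hn
  · have hedge := hC.hasPath_top_bot 2 even_two le_rfl htwo
    exact ⟨2, by omega, by omega, by omega,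
      (HasPath.singleton hedge.left_mem).concat hC.adj_apex_top.symm hC.apex_notMem,
      (HasPath.singleton hedge.symm.left_mem).concat hC.adj_apex_bot.symm hC.apex_notMem⟩
  · have heven : Even (2 * (n / 2)) := even_two_mul _
    have hle : 2 * (n / 2) ≤ #C.body := by
      obtain ⟨k, hk⟩ := hC.even_card_body
      omega
    have hacross := hC.hasPath_top_bot _ heven (by omega) hle
    exact ⟨2 * (n / 2) + 1, by omega, by omega, by omega,
      hacross.concat hC.adj_apex_bot.symm hC.apex_notMem,
      hacross.symm.concat hC.adj_apex_top.symm hC.apex_notMem⟩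

end IsTraversable

end Column

section Peeling

variable [DecidableEq ι] {I : Finset ι} {C : ι → Column α} {i j : ι}

theorem vertices_union_biUnion_erase (hi : i ∈ I) :
    (C i).vertices ∪ (I.erase i).biUnion (fun k => (C k).vertices) =
      I.biUnion fun k => (C k).vertices := by
  conv_rhs => rw [← insert_erase hi, biUnion_insert]

theorem exists_hasPath_erase_of_card_lt (hij : HasPath H I i j #I)
    (hlt : #(C i).vertices < #(I.biUnion fun k => (C k).vertices)) :
    ∃ i' ∈ I, H.Adj i i' ∧ HasPath H (I.erase i) i' j #(I.erase i) := by
  have hi := hij.left_mem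
  have hne : (I.erase i).Nonempty := by
    by_contra hempty
    rw [← vertices_union_biUnion_erase hi, not_nonempty_iff_eq_empty.mp hempty, biUnion_empty,
      union_empty] at hlt
    exact hlt.false
  obtain ⟨k, hk⟩ := Nat.exists_eq_add_one_of_ne_zero hne.card_ne_zero
  rw [← card_erase_add_one hi, hk] at hij
  obtain ⟨i', hii', hi'j⟩ := hij.exists_erase_left
  exact ⟨i', (mem_erase.mp hi'j.left_mem).2, hii', hk ▸ hi'j⟩

end Peeling

/-- A family of disjoint traversable columns of `Γ`, indexed by the vertices of `H` in `I`, such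
that columns with adjacent indices are linked at their apices, at their tops and at their
bottoms. -/
structure IsStrip (H : SimpleGraph ι) (Γ : SimpleGraph α) (I : Finset ι) (C : ι → Column α) :
    Prop where
  isTraversable : ∀ i ∈ I, (C i).IsTraversable Γ
  disjoint : ∀ i ∈ I, ∀ j ∈ I, i ≠ j → Disjoint (C i).vertices (C j).vertices
  adj_apex : ∀ i ∈ I, ∀ j ∈ I, H.Adj i j → Γ.Adj (C i).apex (C j).apex
  adj_top : ∀ i ∈ I, ∀ j ∈ I, H.Adj i j → Γ.Adj (C i).top (C j).top
  adj_bot : ∀ i ∈ I, ∀ j ∈ I, H.Adj i j → Γ.Adj (C i).bot (C j).bot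

namespace IsStrip

variable {I J : Finset ι} {C : ι → Column α} {i j : ι} {n : ℕ}

theorem mono (hI : IsStrip H Γ I C) (hJ : J ⊆ I) : IsStrip H Γ J C where
  isTraversable i hi := hI.isTraversable i (hJ hi)
  disjoint i hi j hj := hI.disjoint i (hJ hi) j (hJ hj)
  adj_apex i hi j hj := hI.adj_apex i (hJ hi) j (hJ hj)
  adj_top i hi j hj := hI.adj_top i (hJ hi) j (hJ hj)
  adj_bot i hi j hj := hI.adj_bot i (hJ hi) j (hJ hj)

theorem disjoint_biUnion_erase [DecidableEq ι] (hI : IsStrip H Γ I C) (hi : i ∈ I) :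
    Disjoint (C i).vertices ((I.erase i).biUnion fun k => (C k).vertices) := by
  rw [disjoint_biUnion_right]
  intro k hk
  obtain ⟨hki, hkI⟩ := mem_erase.mp hk
  exact hI.disjoint i hi k hkI hki.symm

theorem card_biUnion [DecidableEq ι] (hI : IsStrip H Γ I C) (hi : i ∈ I) :
    #(I.biUnion fun k => (C k).vertices) =
      #(C i).body + 1 + #((I.erase i).biUnion fun k => (C k).vertices) := by
  rw [← vertices_union_biUnion_erase hi, card_union_of_disjoint (hI.disjoint_biUnion_erase hi),
    (hI.isTraversable i hi).card_vertices]

theorem three_le_card_biUnion (hI : IsStrip H Γ I C) (hi : i ∈ I) :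
    3 ≤ #(I.biUnion fun k => (C k).vertices) := by
  classical
  have htwo := (hI.isTraversable i hi).two_le_card_body
  have hcard := hI.card_biUnion hi
  omega

/-- The path crosses the body of the first column, makes a round trip through the remaining columns,
and ends at the apex of the first column. Parity allows no exact control of its order, since the
bodies can be crossed only by paths of even order. -/
theorem exists_hasPath_apex (hI : IsStrip H Γ I C) (hij : HasPath H I i j #I) (hn : 1 ≤ n)
    (hcard : n ≤ #(I.biUnion fun k => (C k).vertices)) :
    ∃ n', n ≤ n' ∧ n' ≤ n + 1 ∧ n' ≤ #(I.biUnion fun k => (C k).vertices) ∧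
      HasPath Γ (I.biUnion fun k => (C k).vertices) (C i).top (C i).apex n' ∧
      HasPath Γ (I.biUnion fun k => (C k).vertices) (C i).bot (C i).apex n' := by
  classical
  induction I using Finset.strongInduction generalizing i n with
  | H I ih =>
    have hi := hij.left_mem
    have hCi := hI.isTraversable i hi
    rcases le_or_gt n #(C i).vertices with hle | hgt
    · have hsubset : (C i).vertices ⊆ I.biUnion fun k => (C k).vertices :=
        subset_biUnion_of_mem (fun k => (C k).vertices) hi
      obtain ⟨n', hn', hn'n, hn'card, htop, hbot⟩ := hCi.exists_hasPath_apex hn hle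
      exact ⟨n', hn', hn'n, hn'card.trans (card_le_card hsubset), htop.mono hsubset,
        hbot.mono hsubset⟩
    · obtain ⟨i', hi', hii', hi'j⟩ := exists_hasPath_erase_of_card_lt hij (hgt.trans_le hcard)
      have hsize := hI.card_biUnion hi
      rw [hCi.card_vertices] at hgt
      obtain ⟨n', hn', hn'n, hn'card, htop, hbot⟩ := ih _ (erase_ssubset hi)
        (hI.mono (erase_subset i I)) hi'j (n := n - (#(C i).body + 1)) (by omega) (by omega)
      have hcross := hCi.hasPath_top_bot _ hCi.even_card_body hCi.two_le_card_body le_rfl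
      have hback := (hI.adj_apex i hi i' hi' hii').symm
      have hdisjoint := hI.disjoint_biUnion_erase hi
      refine ⟨#(C i).body + n' + 1, by omega, by omega, by omega, ?_⟩
      rw [← vertices_union_biUnion_erase hi]
      exact ⟨hCi.hasPath_detour hcross (hI.adj_bot i hi i' hi' hii') hbot hback hdisjoint,
        hCi.hasPath_detour hcross.symm (hI.adj_top i hi i' hi' hii') htop hback hdisjoint⟩

/-- The cycle visits the remaining columns on a path whose order is off by at most one; the body of
the first column, where every order is available, makes up for the difference. -/
theorem isPancyclicOn (hI : IsStrip H Γ I C) (hH : IsTraceableOn H I) :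
    IsPancyclicOn Γ (I.biUnion fun k => (C k).vertices) := by
  classical
  intro n hn hcard
  obtain ⟨i, j, hij⟩ := hH
  have hi := hij.left_mem
  have hCi := hI.isTraversable i hi
  have htwo := hCi.two_le_card_body
  have hsize := hI.card_biUnion hi
  rcases le_or_gt n #(C i).vertices with hle | hgt
  · rw [hCi.card_vertices] at hle
    obtain ⟨x, hx, hpath⟩ := hCi.exists_hasPath_bot (n - 1) (by omega) (by omega)
    refine ⟨(C i).bot, (C i).apex, hCi.adj_apex_bot, ?_⟩
    have hcycle := hpath.symm.concat hx.symm hCi.apex_notMem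
    rw [Nat.sub_add_cancel (by omega)] at hcycle
    exact hcycle.mono (subset_biUnion_of_mem (fun k => (C k).vertices) hi)
  · obtain ⟨i', hi', hii', hi'j⟩ := exists_hasPath_erase_of_card_lt hij (hgt.trans_le hcard)
    rw [hCi.card_vertices] at hgt
    obtain ⟨n', hn', hn'n, -, -, hbot⟩ := (hI.mono (erase_subset i I)).exists_hasPath_apex
      hi'j (n := n - (#(C i).body + 1)) (by omega) (by omega)
    obtain ⟨x, hx, hpath⟩ := hCi.exists_hasPath_bot (n - 1 - n') (by omega) (by omega)
    refine ⟨x, (C i).apex, hx, ?_⟩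
    have hcycle := hCi.hasPath_detour hpath (hI.adj_bot i hi i' hi' hii') hbot
      (hI.adj_apex i hi i' hi' hii').symm (hI.disjoint_biUnion_erase hi)
    rwa [vertices_union_biUnion_erase hi, show n - 1 - n' + n' + 1 = n by omega] at hcycle

end IsStrip

variable {V : Type*} [DecidableEq V] {A B Z : Finset V} {l : V}

/-- A path of odd order arises from one of even order by dropping the top of the interval; it then
starts at a coatom. -/
theorem isTraversable_Icc {Γ : SimpleGraph (Finset V)} (hΓ : hasse (Finset V) ≤ Γ) (hBA : B ⊆ A)
    (hl : l ∈ A \ B) (hZ : Z ∉ Icc B A) (hZA : Γ.Adj Z A)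
    (hZerase : ∀ a ∈ A \ B, Γ.Adj Z (A.erase a)) :
    Column.IsTraversable ⟨Z, A, A.erase l, Icc B A⟩ Γ where
  apex_notMem := hZ
  even_card_body := even_card_Icc hBA hl
  two_le_card_body := two_le_card_Icc hBA hl
  adj_apex_top := hZA
  adj_apex_bot := hZerase l hl
  hasPath_top_bot _ hn hn2 hcard := (hasPath_Icc hBA hl hn hn2 hcard).mono_graph hΓ
  exists_hasPath_bot n hn hcard := by
    rcases n.even_or_odd with heven | hodd
    · have hn2 : 2 ≤ n := by grind
      exact ⟨A, hZA, (hasPath_Icc hBA hl heven hn2 hcard).mono_graph hΓ⟩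
    · obtain ⟨k, rfl⟩ := hodd
      have hsucc : 2 * k + 2 ≤ #(Icc B A) := by
        obtain ⟨c, hc⟩ := even_card_Icc hBA hl
        grind
      obtain ⟨X, hAX, hX⟩ :=
        (hasPath_Icc hBA hl (by simp [parity_simps]) (by omega) hsucc).exists_erase_left
      obtain ⟨a, ha, rfl⟩ := exists_eq_erase_of_hasse_adj hAX (mem_erase.mp hX.left_mem).2
      exact ⟨_, hZerase a ha, (hX.mono (erase_subset _ _)).mono_graph hΓ⟩

end Strips

section PendantStars

variable {V : Type*}

theorem eq_snd_of_adj_start_of_forall_length_le {F : SimpleGraph V} (hF : F.IsAcyclic) {x y z : V}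
    {p : F.Walk x z} (hp : p.IsPath)
    (hmax : ∀ (a b : V) (q : F.Walk a b), q.IsPath → q.length ≤ p.length) (hxy : F.Adj x y) :
    y = p.snd := by
  refine hF.eq_snd_of_adj_start hp hxy (by_contra fun hy => ?_)
  simpa using hmax _ _ _ (hp.cons (h := hxy.symm) hy)

/-- Take a longest path `u, v, w, …`. Replacing `u` by another neighbour `x ≠ w` of `v` gives
another longest path, so every such `x` is a leaf. -/
theorem exists_adj_forall_adj_leaf [Finite V] {F : SimpleGraph V} (hF : F.IsAcyclic) {a b : V}
    (hab : F.Adj a b) :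
    ∃ u v w, F.Adj v u ∧ u ≠ w ∧ (w = v ∨ F.Adj v w) ∧
      ∀ x, F.Adj v x → x ≠ w → ∀ y, F.Adj x y → y = v := by
  have : Nonempty V := ⟨a⟩
  obtain ⟨u, z, p, hp, hmax⟩ := Walk.exists_isPath_forall_isPath_length_le_length F
  cases p with
  | nil => simpa using hmax a b (.cons hab .nil) (by simp [hab.ne])
  | @cons _ v _ huv q =>
    obtain ⟨hq, hu⟩ := Walk.cons_isPath_iff huv q |>.mp hp
    refine ⟨u, v, q.snd, huv.symm, ?_, ?_, fun x hvx hx y hxy => ?_⟩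
    · rintro rfl
      exact hu (q.getVert_mem_support 1)
    · cases q with
      | nil => exact .inl rfl
      | cons hvw _ => exact .inr (by simpa using hvw)
    · have hxq : x ∉ q.support := fun hmem => hx (hF.eq_snd_of_adj_start hq hvx hmem)
      simpa using eq_snd_of_adj_start_of_forall_length_le hF (hq.cons (h := hvx.symm) hxq)
        (by simpa using hmax) hxy

variable [DecidableEq V] {G : SimpleGraph V} {H L U : Finset V} {v w : V}

/-- In the subgraph of `G` induced on the disjoint union of `H` and `insert v L`, the vertices of
`L` are leaves attached to `v`, and `v` has at most one neighbour in `H`. That neighbour is `w`; if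
there is none, then `w` is any vertex outside `H`. -/
structure IsPendantStar (G : SimpleGraph V) (H L : Finset V) (v w : V) : Prop where
  nonempty : L.Nonempty
  disjoint : Disjoint H (insert v L)
  adj_leaf_iff : ∀ l ∈ L, ∀ x ∈ H ∪ insert v L, G.Adj l x ↔ x = v
  adj_center_iff : ∀ x ∈ H, G.Adj v x ↔ x = w

theorem exists_isPendantStar (hG : G.IsAcyclic) {a b : V} (ha : a ∈ U) (hb : b ∈ U)
    (hab : G.Adj a b) : ∃ H L v w, IsPendantStar G H L v w ∧ U = H ∪ insert v L := by
  classical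
  have hab' : (G.induce (U : Set V)).Adj ⟨a, ha⟩ ⟨b, hb⟩ := hab
  obtain ⟨⟨u, hu⟩, ⟨v, hv⟩, ⟨w, hw⟩, hvu, huw, hwv, hleaf⟩ :=
    exists_adj_forall_adj_leaf (hG.induce _) hab'
  simp only [SetLike.mem_coe, comap_adj, Function.Embedding.subtype_apply, Subtype.forall,
    Subtype.mk.injEq, ne_eq] at hu hv hw hvu huw hwv hleaf
  set L := {x ∈ U | G.Adj v x ∧ x ≠ w}
  have hstar : insert v L ⊆ U := insert_subset hv (filter_subset _ _)
  refine ⟨U \ insert v L, L, v, w, ⟨⟨u, by simp [L, hu, hvu, huw]⟩, sdiff_disjoint, ?_, ?_⟩,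
    (sdiff_union_of_subset hstar).symm⟩
  · rw [sdiff_union_of_subset hstar]
    intro l hl x hx
    obtain ⟨hlU, hvl, hlw⟩ := mem_filter.mp hl
    refine ⟨hleaf l hlU hvl hlw x hx, ?_⟩
    rintro rfl
    exact hvl.symm
  · intro x hx
    simp only [mem_sdiff, mem_insert, L, mem_filter, not_or] at hx
    grind

end PendantStars

section TokenGraph

variable {V : Type*} [DecidableEq V] {G : SimpleGraph V}

/-- The TARS-graph without the restriction to dominating sets: the token moves on all finite sets of
vertices. Fixing the ambient graph allows dominating sets of subgraphs to be compared. -/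
def tokenGraph (G : SimpleGraph V) : SimpleGraph (Finset V) where
  Adj X Y := TokenAddRemove X Y ∨ G.TokenSlide X Y
  symm := ⟨fun _ _ h => h.imp TokenAddRemove.symm TokenSlide.symm⟩
  loopless := ⟨by
    rintro X ((⟨v, hv, h⟩ | ⟨v, hv, h⟩) | ⟨u, v, _, hv, _, _⟩)
    · exact hv (h ▸ mem_insert_self v X)
    · exact notMem_erase v X (h ▸ hv)
    · simp at hv⟩

theorem tokenGraph_adj_insert {X : Finset V} {v : V} (hv : v ∉ X) :
    (tokenGraph G).Adj X (insert v X) :=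
  .inl (.inl ⟨v, hv, rfl⟩)

theorem hasse_le_tokenGraph : hasse (Finset V) ≤ tokenGraph G := by
  have hcovBy {X Y : Finset V} (h : X ⋖ Y) : (tokenGraph G).Adj X Y := by
    obtain ⟨v, hv, rfl⟩ := covBy_iff_exists_insert.mp h
    exact tokenGraph_adj_insert hv
  intro X Y h
  exact (hasse_adj.mp h).elim hcovBy fun h' => (hcovBy h').symm

theorem tokenGraph_adj_erase_erase {A : Finset V} {u v : V} (hu : u ∈ A) (hv : v ∈ A)
    (huv : G.Adj u v) : (tokenGraph G).Adj (A.erase v) (A.erase u) :=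
  .inr ⟨u, v, mem_erase.mpr ⟨huv.ne, hu⟩, by simp [hv, huv.ne'], huv, by rw [insert_erase hv]⟩

theorem tokenGraph_adj_union {X Y J : Finset V} (h : (tokenGraph G).Adj X Y) (hX : Disjoint X J)
    (hY : Disjoint Y J) : (tokenGraph G).Adj (X ∪ J) (Y ∪ J) := by
  rw [Finset.disjoint_left] at hX hY
  rcases h with (⟨u, hu, rfl⟩ | ⟨u, hu, rfl⟩) | ⟨u, v, hu, hv, huv, rfl⟩
  · exact .inl (.inl ⟨u, by grind, by grind⟩)
  · exact .inl (.inr ⟨u, by grind, by grind⟩)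
  · exact .inr ⟨u, v, by grind, by grind, huv, by grind⟩

end TokenGraph

section Domination

variable {V : Type*} {G : SimpleGraph V} {S S' U W : Finset V}

/-- Every vertex of `W` lies in `S` or has a neighbour in `S`. Not requiring `S ⊆ W` allows vertices
to be dominated from outside. -/
def Dominates (G : SimpleGraph V) (S W : Finset V) : Prop :=
  ∀ x ∈ W, x ∉ S → ∃ u ∈ S, G.Adj u x

theorem Dominates.mono {W' : Finset V} (h : Dominates G S W) (hS : S ⊆ S') (hW : W' ⊆ W) :
    Dominates G S' W' := fun x hx hxS' =>
  let ⟨u, hu, hux⟩ := h x (hW hx) fun hxS => hxS' (hS hxS)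
  ⟨u, hS hu, hux⟩

open Classical in
/-- The dominating sets of the subgraph of `G` induced on `U`, as sets of vertices of `G`. -/
noncomputable def dominatingSets (G : SimpleGraph V) (U : Finset V) : Finset (Finset V) :=
  {S ∈ U.powerset | Dominates G S U}

theorem mem_dominatingSets : S ∈ dominatingSets G U ↔ S ⊆ U ∧ Dominates G S U := by
  simp [dominatingSets]

theorem mem_dominatingSets_univ [Fintype V] :
    S ∈ dominatingSets G univ ↔ G.IsDominating S := by
  simp [mem_dominatingSets, Dominates, IsDominating]

theorem dominatingSets_eq_singleton (hU : ∀ a ∈ U, ∀ b ∈ U, ¬ G.Adj a b) :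
    dominatingSets G U = {U} := by
  ext S
  rw [mem_dominatingSets, mem_singleton]
  constructor
  · rintro ⟨hSU, hS⟩
    refine hSU.antisymm fun x hx => by_contra fun hxS => ?_
    obtain ⟨u, hu, hux⟩ := hS x hx hxS
    exact hU u (hSU hu) x hx hux
  · rintro rfl
    exact ⟨Subset.rfl, fun x hx hxS => absurd hx hxS⟩

end Domination

section Completion

variable {V : Type*} [DecidableEq V] {G : SimpleGraph V} {H P Q : Finset V} {w : V}

open Classical in
/-- The smallest dominating set of `H` that contains `P`, provided that `P` dominates all vertices
of `H` but possibly `w`. -/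
noncomputable def completion (G : SimpleGraph V) (H : Finset V) (w : V) (P : Finset V) :
    Finset V :=
  if Dominates G P H then P else insert w P

open Classical in
/-- The smallest set `P` dominating `H.erase w` such that `completion G H w P = Q`. -/
noncomputable def completionFloor (G : SimpleGraph V) (H : Finset V) (w : V) (Q : Finset V) :
    Finset V :=
  if Dominates G (Q.erase w) (H.erase w) ∧ ¬ Dominates G (Q.erase w) H then Q.erase w else Q

theorem completion_mem_dominatingSets (hPH : P ⊆ H) (hP : Dominates G P (H.erase w)) :
    completion G H w P ∈ dominatingSets G H := by
  rw [mem_dominatingSets, completion]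
  split_ifs with hPdom
  · exact ⟨hPH, hPdom⟩
  · have hw : w ∈ H := by
      by_contra hw
      exact hPdom (by rwa [erase_eq_of_notMem hw] at hP)
    refine ⟨insert_subset hw hPH, fun x hx hxP => ?_⟩
    exact hP.mono (subset_insert w P) Subset.rfl x (by grind) hxP

theorem completionFloor_subset : completionFloor G H w Q ⊆ Q := by
  rw [completionFloor]
  split_ifs
  exacts [erase_subset w Q, Subset.rfl]

theorem eq_of_mem_sdiff_completionFloor {a : V} (ha : a ∈ Q \ completionFloor G H w Q) : a = w := by
  rw [completionFloor] at ha
  grind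

theorem mem_Icc_completionFloor (hQ : Q ∈ dominatingSets G H) :
    P ∈ Icc (completionFloor G H w Q) Q ↔
      P ⊆ H ∧ Dominates G P (H.erase w) ∧ completion G H w P = Q := by
  obtain ⟨hQH, hQdom⟩ := mem_dominatingSets.mp hQ
  rw [mem_Icc, completion]
  constructor
  · rintro ⟨hfloor, hPQ⟩
    rw [completionFloor] at hfloor
    obtain rfl | hPne := eq_or_ne P Q
    · exact ⟨hQH, hQdom.mono Subset.rfl (erase_subset w H), if_pos hQdom⟩
    · split_ifs at hfloor with herase
      · have hP : P = Q.erase w := by grind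
        have hw : w ∈ Q := by grind
        subst hP
        exact ⟨hPQ.trans hQH, herase.1, by rw [if_neg herase.2, insert_erase hw]⟩
      · exact absurd (hPQ.antisymm hfloor) hPne
  · rintro ⟨-, hP, rfl⟩
    split_ifs with hPdom
    · exact ⟨completionFloor_subset, le_rfl⟩
    · have hw : w ∉ P := fun hw => hPdom fun x hx hxP => hP x (by grind) hxP
      rw [completionFloor, erase_insert hw, if_pos ⟨hP, hPdom⟩]
      exact ⟨Subset.rfl, subset_insert w P⟩

end Completion

section StarColumns

variable {V : Type*} [DecidableEq V] {G : SimpleGraph V} {H L Q S : Finset V} {v w l : V}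

/-- The column of dominating sets of `H ∪ insert v L` over a dominating set `Q` of `H`. The apex is
the only member that does not contain `v`; the others meet `H` in a set whose completion is `Q`. The
leaf `l` is an arbitrary choice. -/
noncomputable def starColumn (G : SimpleGraph V) (H L : Finset V) (v w l : V) (Q : Finset V) :
    Column (Finset V) where
  apex := Q ∪ L
  top := Q ∪ insert v L
  bot := (Q ∪ insert v L).erase l
  body := Icc (insert v (completionFloor G H w Q)) (Q ∪ insert v L)

/-- The dominating set of `H` over which the column containing `S` stands. If `v ∈ S`, then `v`
dominates `w`, so that `S ∩ H` itself need not dominate `H`. -/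
noncomputable def starColumnIndex (G : SimpleGraph V) (H : Finset V) (v w : V) (S : Finset V) :
    Finset V :=
  if v ∈ S then completion G H w (S ∩ H) else S ∩ H

namespace IsPendantStar

variable (h : IsPendantStar G H L v w)
include h

theorem center_notMem_core : v ∉ H :=
  Finset.disjoint_right.mp h.disjoint (mem_insert_self v L)

theorem center_notMem_leaves : v ∉ L := fun hv =>
  G.irrefl ((h.adj_leaf_iff v hv v (by simp)).mpr rfl)

theorem disjoint_leaves : Disjoint H L :=
  h.disjoint.mono_right (subset_insert v L)

theorem dominates_iff_of_center_mem (hS : S ⊆ H ∪ insert v L) (hv : v ∈ S) :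
    Dominates G S (H ∪ insert v L) ↔ Dominates G (S ∩ H) (H.erase w) := by
  constructor
  · intro hdom x hx hxS
    obtain ⟨hxw, hxH⟩ := mem_erase.mp hx
    obtain ⟨u, huS, hux⟩ := hdom x (by simp [hxH]) fun hxS' => hxS (mem_inter.mpr ⟨hxS', hxH⟩)
    have huv : u ≠ v := by
      rintro rfl
      exact hxw ((h.adj_center_iff x hxH).mp hux)
    have huL : u ∉ L := fun huL => by
      rw [(h.adj_leaf_iff u huL x (by simp [hxH])).mp hux] at hxH
      exact h.center_notMem_core hxH
    exact ⟨u, by grind, hux⟩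
  · intro hdom x hx hxS
    rcases mem_union.mp hx with hxH | hxL
    · obtain rfl | hxw := eq_or_ne x w
      · exact ⟨v, hv, (h.adj_center_iff x hxH).mpr rfl⟩
      · obtain ⟨u, hu, hux⟩ := hdom x (by simp [hxw, hxH]) (by simp [hxS])
        exact ⟨u, mem_of_mem_inter_left hu, hux⟩
    · have hxL' : x ∈ L := mem_of_mem_insert_of_ne hxL fun hxv => hxS (hxv ▸ hv)
      exact ⟨v, hv, ((h.adj_leaf_iff x hxL' v (by simp)).mpr rfl).symm⟩

theorem dominates_iff_of_center_notMem (hS : S ⊆ H ∪ insert v L) (hv : v ∉ S) :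
    Dominates G S (H ∪ insert v L) ↔ L ⊆ S ∧ Dominates G (S ∩ H) H := by
  constructor
  · refine fun hdom => ⟨fun x hx => by_contra fun hxS => ?_, fun x hx hxS => ?_⟩
    · obtain ⟨u, hu, hux⟩ := hdom x (by simp [hx]) hxS
      exact hv ((h.adj_leaf_iff x hx u (hS hu)).mp hux.symm ▸ hu)
    · obtain ⟨u, hu, hux⟩ := hdom x (by simp [hx]) fun hxS' => hxS (mem_inter.mpr ⟨hxS', hx⟩)
      have huL : u ∉ L := fun huL => by
        rw [(h.adj_leaf_iff u huL x (by simp [hx])).mp hux] at hx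
        exact h.center_notMem_core hx
      exact ⟨u, by grind, hux⟩
  · rintro ⟨hLS, hdom⟩ x hx hxS
    rcases mem_union.mp hx with hxH | hxL
    · obtain ⟨u, hu, hux⟩ := hdom x hxH (by simp [hxS])
      exact ⟨u, mem_of_mem_inter_left hu, hux⟩
    · obtain rfl : x = v := (mem_insert.mp hxL).resolve_right fun hx' => hxS (hLS hx')
      obtain ⟨l, hl⟩ := h.nonempty
      exact ⟨l, hLS hl, (h.adj_leaf_iff l hl x (by simp)).mpr rfl⟩

theorem starColumnIndex_mem_dominatingSets (hS : S ∈ dominatingSets G (H ∪ insert v L)) :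
    starColumnIndex G H v w S ∈ dominatingSets G H := by
  obtain ⟨hSU, hdom⟩ := mem_dominatingSets.mp hS
  rw [starColumnIndex]
  split_ifs with hv
  · exact completion_mem_dominatingSets inter_subset_right
      ((h.dominates_iff_of_center_mem hSU hv).mp hdom)
  · exact mem_dominatingSets.mpr
      ⟨inter_subset_right, ((h.dominates_iff_of_center_notMem hSU hv).mp hdom).2⟩

theorem mem_vertices_starColumn (hQ : Q ∈ dominatingSets G H) :
    S ∈ (starColumn G H L v w l Q).vertices ↔
      S ∈ dominatingSets G (H ∪ insert v L) ∧ starColumnIndex G H v w S = Q := by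
  obtain ⟨hQH, hQdom⟩ := mem_dominatingSets.mp hQ
  have hfloor : completionFloor G H w Q ⊆ Q := completionFloor_subset
  have hvH := h.center_notMem_core
  have hvL := h.center_notMem_leaves
  have hHL := Finset.disjoint_left.mp h.disjoint_leaves
  rw [Column.vertices, mem_insert, mem_dominatingSets, starColumnIndex, starColumn]
  by_cases hv : v ∈ S
  · have hapex : S ≠ Q ∪ L := by grind
    have hbody : S ∈ Icc (insert v (completionFloor G H w Q)) (Q ∪ insert v L) ↔
        S ⊆ H ∪ insert v L ∧ S ∩ H ∈ Icc (completionFloor G H w Q) Q := by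
      simp only [mem_Icc]
      grind
    have hdom := fun hSU : S ⊆ H ∪ insert v L => h.dominates_iff_of_center_mem hSU hv
    simp only [hapex, false_or, hbody, mem_Icc_completionFloor hQ, hv, if_true]
    grind
  · have hbody : S ∉ Icc (insert v (completionFloor G H w Q)) (Q ∪ insert v L) := by
      simp only [mem_Icc]
      grind
    have hapex : S = Q ∪ L ↔ S ⊆ H ∪ insert v L ∧ L ⊆ S ∧ S ∩ H = Q := by grind
    have hdom := fun hSU : S ⊆ H ∪ insert v L => h.dominates_iff_of_center_notMem hSU hv
    simp only [hbody, or_false, hapex, hv, if_false]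
    grind

theorem biUnion_vertices_starColumn :
    (dominatingSets G H).biUnion (fun Q => (starColumn G H L v w l Q).vertices) =
      dominatingSets G (H ∪ insert v L) := by
  ext S
  rw [mem_biUnion]
  constructor
  · rintro ⟨Q, hQ, hS⟩
    exact ((h.mem_vertices_starColumn hQ).mp hS).1
  · intro hS
    have hQ := h.starColumnIndex_mem_dominatingSets hS
    exact ⟨_, hQ, (h.mem_vertices_starColumn hQ).mpr ⟨hS, rfl⟩⟩

theorem isTraversable_starColumn (hl : l ∈ L) (hQ : Q ∈ dominatingSets G H) :
    (starColumn G H L v w l Q).IsTraversable (tokenGraph G) := by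
  have hQH : Q ⊆ H := (mem_dominatingSets.mp hQ).1
  have hfloor : completionFloor G H w Q ⊆ Q := completionFloor_subset
  have hvH := h.center_notMem_core
  have hvL := h.center_notMem_leaves
  have hHL := Finset.disjoint_left.mp h.disjoint_leaves
  have hv : v ∉ Q ∪ L := by grind
  have htop : Q ∪ insert v L = insert v (Q ∪ L) := union_insert v Q L
  have hfloor_top : insert v (completionFloor G H w Q) ⊆ Q ∪ insert v L := by grind
  have hl' : l ∈ (Q ∪ insert v L) \ insert v (completionFloor G H w Q) := by grind
  have hapex : Q ∪ L ∉ Icc (insert v (completionFloor G H w Q)) (Q ∪ insert v L) :=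
    fun hmem => hv ((mem_Icc.mp hmem).1 (mem_insert_self v _))
  refine isTraversable_Icc hasse_le_tokenGraph hfloor_top hl' hapex
    (htop ▸ tokenGraph_adj_insert hv) fun a ha => ?_
  have hav : G.Adj a v := by
    obtain ⟨haA, hafloor⟩ := mem_sdiff.mp ha
    by_cases haL : a ∈ L
    · exact (h.adj_leaf_iff a haL v (by simp)).mpr rfl
    · have haQ : a ∈ Q \ completionFloor G H w Q := by grind
      exact ((h.adj_center_iff a (by grind)).mpr (eq_of_mem_sdiff_completionFloor haQ)).symm
  have hslide := tokenGraph_adj_erase_erase (mem_sdiff.mp ha).1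
    (mem_union_right Q (mem_insert_self v L)) hav
  rwa [show (Q ∪ insert v L).erase v = Q ∪ L by rw [htop, erase_insert hv]] at hslide

theorem isStrip_starColumn (hl : l ∈ L) :
    IsStrip (tokenGraph G) (tokenGraph G) (dominatingSets G H) (starColumn G H L v w l) := by
  have hadj {Q Q' J : Finset V} (hJ : Disjoint H J) (hQ : Q ∈ dominatingSets G H)
      (hQ' : Q' ∈ dominatingSets G H) (hQQ' : (tokenGraph G).Adj Q Q') :
      (tokenGraph G).Adj (Q ∪ J) (Q' ∪ J) :=
    tokenGraph_adj_union hQQ' (hJ.mono_left (mem_dominatingSets.mp hQ).1)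
      (hJ.mono_left (mem_dominatingSets.mp hQ').1)
  have hbot {Q : Finset V} (hQ : Q ∈ dominatingSets G H) :
      (Q ∪ insert v L).erase l = Q ∪ (insert v L).erase l := by
    rw [erase_union_distrib, erase_eq_of_notMem]
    exact fun hlQ =>
      Finset.disjoint_right.mp h.disjoint_leaves hl ((mem_dominatingSets.mp hQ).1 hlQ)
  refine ⟨fun Q hQ => h.isTraversable_starColumn hl hQ, fun Q hQ Q' hQ' hne => ?_,
    fun Q hQ Q' hQ' => hadj h.disjoint_leaves hQ hQ',
    fun Q hQ Q' hQ' => hadj h.disjoint hQ hQ', fun Q hQ Q' hQ' hQQ' => ?_⟩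
  · rw [Finset.disjoint_left]
    intro S hS hS'
    rw [h.mem_vertices_starColumn hQ] at hS
    rw [h.mem_vertices_starColumn hQ'] at hS'
    exact hne (hS.2.symm.trans hS'.2)
  · rw [starColumn, starColumn, hbot hQ, hbot hQ']
    exact hadj (h.disjoint.mono_right (erase_subset l _)) hQ hQ' hQQ'

end IsPendantStar

theorem isTraceableOn_and_isPancyclicOn_dominatingSets (hG : G.IsAcyclic) (U : Finset V) :
    IsTraceableOn (tokenGraph G) (dominatingSets G U) ∧
      IsPancyclicOn (tokenGraph G) (dominatingSets G U) := by
  induction U using Finset.strongInduction with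
  | H U ih =>
    by_cases hU : ∀ a ∈ U, ∀ b ∈ U, ¬ G.Adj a b
    · rw [dominatingSets_eq_singleton hU]
      exact ⟨isTraceableOn_singleton U, isPancyclicOn_singleton U⟩
    · push Not at hU
      obtain ⟨a, ha, b, hb, hab⟩ := hU
      obtain ⟨H, L, v, w, hstar, rfl⟩ := exists_isPendantStar hG ha hb hab
      have hH : H ⊂ H ∪ insert v L :=
        ⟨subset_union_left, fun hsubset => hstar.center_notMem_core (hsubset (by simp))⟩
      obtain ⟨l, hl⟩ := hstar.nonempty
      have htraceable := (ih H hH).1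
      have hpancyclic := (hstar.isStrip_starColumn hl).isPancyclicOn htraceable
      obtain ⟨Q, _, hQ⟩ := htraceable
      have hcard := (hstar.isStrip_starColumn hl).three_le_card_biUnion hQ.left_mem
      rw [hstar.biUnion_vertices_starColumn] at hpancyclic hcard
      exact ⟨hpancyclic.isTraceableOn hcard, hpancyclic⟩

end StarColumns

end TarsGraph

theorem mainTheorem1_general {V : Type*} [Finite V] [DecidableEq V] (F : SimpleGraph V)
    (hF : F.IsAcyclic) : F.tarsGraph.IsPancyclic := by
  have := Fintype.ofFinite V
  intro n hn hcard
  rw [Nat.subtype_card (TarsGraph.dominatingSets F .univ)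
    fun S => TarsGraph.mem_dominatingSets_univ] at hcard
  obtain ⟨X, Y, hYX, hXY⟩ :=
    (TarsGraph.isTraceableOn_and_isPancyclicOn_dominatingSets hF .univ).2 n hn hcard
  exact hXY.exists_isCycle_induce (s := {S | F.IsDominating S}) hYX hn
    fun S => TarsGraph.mem_dominatingSets_univ.mp

theorem mainTheorem1 {V : Type*} [Fintype V] [DecidableEq V] (T : SimpleGraph V)
    (hT : T.IsTree) : T.tarsGraph.IsPancyclic :=
  mainTheorem1_general T hT.isAcyclic
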